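/- Let $R$ be a unital commutative ring and let $(\mathcal B,\mathcal L,\theta,\mathcal I)$ be a generalized Boolean dynamical system: $\mathcal B$ is a generalized Boolean algebra (a distributive lattice with relative complements and least element $\emptyset$), $\mathcal L$ is a set, $\theta=(\theta_\alpha)_{\alpha\in\mathcal L}$ is a family of maps $\theta_\alpha:\mathcal B\to\mathcal B$ preserving $\emptyset,\cup,\cap,\setminus$, and $\mathcal I=(\mathcal I_\alpha)_{\alpha\in\mathcal L}$ is a family of ideals of $\mathcal B$ such that $A\in\mathcal I_\alpha$ whenever $A\subseteq\theta_\alpha(C)$ for some $C\in\mathcal B$. For $A\in\mathcal B$ put $\Delta_A=\{\alpha\in\mathcal L:\theta_\alpha(A)\neq\emptyset\}$, and let $\mathcal B_{\mathrm{reg}}$ be the set of $A\in\mathcal B$ such that $0<|\Delta_C|<\infty$ for every $\emptyset\ne C\subseteq A$. Let $L_R(\mathcal B,\mathcal L,\theta,\mathcal I)$ be the universal associative, not necessarily unital, $R$-algebra generated by symbols $p_A$ ($A\in\mathcal B$) and $s_{\alpha,A},s^*_{\alpha,A}$ ($\alpha\in\mathcal L$, $A\in\mathcal I_\alpha$) subject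 to 1. $p_\emptyset=0$, $p_{A\cap A'}=p_Ap_{A'}$, $p_{A\cup A'}=p_A+p_{A'}-p_{A\cap A'}$; 2. $p_As_{\alpha,B}=s_{\alpha,B}p_{\theta_\alpha(A)}$ and $s^*_{\alpha,B}p_A=p_{\theta_\alpha(A)}s^*_{\alpha,B}$; 3. $s^*_{\alpha,B}s_{\alpha',B'}=\delta_{\alpha,\alpha'}p_{B\cap B'}$; 4. $s_{\alpha,B}p_{B'}=s_{\alpha,B\cap B'}$ and $p_{B'}s^*_{\alpha,B}=s^*_{\alpha,B\cap B'}$; 5. $p_A=\sum_{\alpha\in\Delta_A}s_{\alpha,\theta_\alpha(A)}s^*_{\alpha,\theta_\alpha(A)}$ for all $A\in\mathcal B_{\mathrm{reg}}$. Let $(\mathcal B,\mathcal L,\theta,\mathcal B)$ be the generalized Boolean dynamical system with the same $\mathcal B,\mathcal L,\theta$ in which every ideal $\mathcal I_\alpha$ is replaced by $\mathcal B$. Then the $R$-algebras $L_R(\mathcal B,\mathcal L,\theta,\mathcal I)$ and $L_R(\mathcal B,\mathcal L,\theta,\mathcal B)$ are Morita equivalent. Here two not necessarily unital $R$-algebras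 $S,T$ are called Morita equivalent if there is a surjective Morita context between them: an $S$-$T$-bimodule $P$ and a $T$-$S$-bimodule $Q$ ($R$-modules with $R$-bilinear actions, unital in the sense that $SP=P=PT$ and $TQ=Q=QS$), and surjective $R$-linear bimodule maps $(\cdot,\cdot):P\otimes_TQ\to S$ and $[\cdot,\cdot]:Q\otimes_SP\to T$ with $(p,q)p'=p[q,p']$ and $[q,p]q'=q(p,q')$ for all $p,p'\in P$, $q,q'\in Q$. -/

import Mathlib

universe u v w

/-- A generalized Boolean dynamical system `(𝓑, 𝓛, θ, 𝓘)` over a generalized Boolean algebra `B`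
(distributive lattice with least element and relative complements) and a set `L` of letters.
Each `θ α` is a morphism of generalized Boolean algebras, and each `I α` is an ideal of `B`
containing every `A` with `A ≤ θ α C` for some `C`. -/
structure GenBoolDynSys (B : Type v) (L : Type w) [GeneralizedBooleanAlgebra B] where
  /-- the actions of the letters -/
  θ : L → B → B
  θ_bot : ∀ α, θ α ⊥ = ⊥
  θ_sup : ∀ α A C, θ α (A ⊔ C) = θ α A ⊔ θ α C
  θ_inf : ∀ α A C, θ α (A ⊓ C) = θ α A ⊓ θ α C
  θ_sdiff : ∀ α A C, θ α (A \ C) = θ α A \ θ α C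
  /-- the ideals attached to the letters -/
  I : L → Order.Ideal B
  mem_I_of_le : ∀ α A C, A ≤ θ α C → A ∈ I α

namespace GenBoolDynSys

variable {B : Type v} {L : Type w} [GeneralizedBooleanAlgebra B]

/-- The system with the same algebra, letters and actions in which every ideal is all of `B`. -/
def full (D : GenBoolDynSys B L) : GenBoolDynSys B L where
  θ := D.θ
  θ_bot := D.θ_bot
  θ_sup := D.θ_sup
  θ_inf := D.θ_inf
  θ_sdiff := D.θ_sdiff
  I := fun _ => ⊤
  mem_I_of_le := fun _ _ _ _ => trivial

/-- `Δ_A`: the set of letters `α` with `θ_α(A) ≠ ∅`. -/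
def Δ (D : GenBoolDynSys B L) (A : B) : Set L := {α | D.θ α A ≠ ⊥}

/-- The regular sets: those `A` with `0 < |Δ_C| < ∞` for every nonempty `C ⊆ A`. -/
def reg (D : GenBoolDynSys B L) : Set B :=
  {A | ∀ C ≤ A, C ≠ ⊥ → (D.Δ C).Nonempty ∧ (D.Δ C).Finite}

theorem finite_Δ (D : GenBoolDynSys B L) {A : B} (hA : A ∈ D.reg) : (D.Δ A).Finite := by
  by_cases h : A = ⊥
  · have : D.Δ A = ∅ := by
      ext α
      simp [Δ, h, D.θ_bot]
    rw [this]
    exact Set.finite_empty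
  · exact (hA A le_rfl h).2

theorem θ_mem_I (D : GenBoolDynSys B L) (α : L) (A : B) : D.θ α A ∈ D.I α :=
  D.mem_I_of_le α _ A le_rfl

/-- The generating symbols `p_A` (`A ∈ B`), `s_{α,A}` and `s*_{α,A}` (`α ∈ L`, `A ∈ I_α`). -/
inductive Gen (D : GenBoolDynSys B L) : Type (max v w)
  | p (A : B) : Gen D
  | s (α : L) (A : B) (hA : A ∈ D.I α) : Gen D
  | sStar (α : L) (A : B) (hA : A ∈ D.I α) : Gen D

section Algebra

variable (R : Type u) [CommRing R] (D : GenBoolDynSys B L)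

/-- The free (associative, not necessarily unital) `R`-algebra on the generating symbols:
the `R`-algebra of the free semigroup on them. -/
abbrev Free : Type (max u v w) := MonoidAlgebra R (FreeSemigroup D.Gen)

/-- A generating symbol as an element of the free algebra. -/
noncomputable def gen (g : D.Gen) : Free R D := MonoidAlgebra.single (FreeSemigroup.of g) 1

/-- The defining relations. -/
inductive Rel : Free R D → Free R D → Prop
  | p_bot : Rel (gen R D (.p ⊥)) 0
  | p_inf (A C : B) : Rel (gen R D (.p (A ⊓ C))) (gen R D (.p A) * gen R D (.p C))
  | p_sup (A C : B) : Rel (gen R D (.p (A ⊔ C)))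
      (gen R D (.p A) + gen R D (.p C) - gen R D (.p (A ⊓ C)))
  | p_s (A : B) (α : L) (C : B) (hC : C ∈ D.I α) :
      Rel (gen R D (.p A) * gen R D (.s α C hC)) (gen R D (.s α C hC) * gen R D (.p (D.θ α A)))
  | sStar_p (A : B) (α : L) (C : B) (hC : C ∈ D.I α) :
      Rel (gen R D (.sStar α C hC) * gen R D (.p A))
        (gen R D (.p (D.θ α A)) * gen R D (.sStar α C hC))
  | sStar_s (α : L) (A C : B) (hA : A ∈ D.I α) (hC : C ∈ D.I α) :
      Rel (gen R D (.sStar α A hA) * gen R D (.s α C hC)) (gen R D (.p (A ⊓ C)))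
  | sStar_s_ne (α β : L) (hαβ : α ≠ β) (A C : B) (hA : A ∈ D.I α) (hC : C ∈ D.I β) :
      Rel (gen R D (.sStar α A hA) * gen R D (.s β C hC)) 0
  | s_p (α : L) (A C : B) (hA : A ∈ D.I α) :
      Rel (gen R D (.s α A hA) * gen R D (.p C))
        (gen R D (.s α (A ⊓ C) ((D.I α).lower inf_le_left hA)))
  | p_sStar (α : L) (A C : B) (hA : A ∈ D.I α) :
      Rel (gen R D (.p C) * gen R D (.sStar α A hA))
        (gen R D (.sStar α (A ⊓ C) ((D.I α).lower inf_le_left hA)))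
  | p_reg (A : B) (hA : A ∈ D.reg) :
      Rel (gen R D (.p A)) (∑ α ∈ (D.finite_Δ hA).toFinset,
        gen R D (.s α (D.θ α A) (D.θ_mem_I α A)) * gen R D (.sStar α (D.θ α A) (D.θ_mem_I α A)))

/-- The smallest `R`-algebra congruence containing the defining relations. (A ring congruence
that contains all `R`-multiples of the defining relations is stable under `R`-multiples.) -/
noncomputable def con : RingCon (Free R D) :=
  ringConGen fun x y => ∃ (r : R) (a b : Free R D), Rel R D a b ∧ x = r • a ∧ y = r • b

theorem con_smul (r : R) {x y : Free R D} (h : con R D x y) : con R D (r • x) (r • y) := by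
  have h' : RingConGen.Rel (fun x y => ∃ (r : R) (a b : Free R D), Rel R D a b ∧
      x = r • a ∧ y = r • b) x y := h
  clear h
  induction h' with
  | of x y h =>
    obtain ⟨t, a, b, hab, rfl, rfl⟩ := h
    exact RingConGen.Rel.of _ _ ⟨r * t, a, b, hab, smul_smul _ _ _, smul_smul _ _ _⟩
  | refl x => exact (con R D).refl _
  | symm _ ih => exact (con R D).symm ih
  | trans _ _ ih₁ ih₂ => exact (con R D).trans ih₁ ih₂
  | add _ _ ih₁ ih₂ =>
    rw [smul_add, smul_add]
    exact (con R D).add ih₁ ih₂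
  | mul _ h₂ ih₁ _ =>
    rw [← smul_mul_assoc, ← smul_mul_assoc]
    exact (con R D).mul ih₁ h₂

/-- The generalized Boolean dynamical system algebra `L_R(𝓑, 𝓛, θ, 𝓘)`: the universal
(associative, not necessarily unital) `R`-algebra on the generating symbols subject to the
defining relations. -/
def Alg : Type (max u v w) := (con R D).Quotient

noncomputable instance : NonUnitalRing (Alg R D) :=
  inferInstanceAs (NonUnitalRing (con R D).Quotient)

/-- The quotient map from the free algebra. -/
noncomputable def toAlg (x : Free R D) : Alg R D := RingCon.toQuotient (c := con R D) x

theorem toAlg_surjective : Function.Surjective (toAlg R D) := fun x => Quotient.inductionOn' x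
  fun a => ⟨a, rfl⟩

noncomputable instance : SMul R (Alg R D) where
  smul r := Quotient.map' (s₁ := (con R D).toSetoid) (s₂ := (con R D).toSetoid) (fun x => r • x)
    fun _ _ h => con_smul R D r h

/-- The quotient map as an additive homomorphism. -/
noncomputable def toAlgAddHom : Free R D →+ Alg R D where
  toFun := toAlg R D
  map_zero' := rfl
  map_add' _ _ := rfl

noncomputable instance : Module R (Alg R D) :=
  Function.Surjective.module R (toAlgAddHom R D) (toAlg_surjective R D) fun _ _ => rfl

instance : IsScalarTower R (Alg R D) (Alg R D) where
  smul_assoc r x y := by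
    obtain ⟨a, rfl⟩ := toAlg_surjective R D x
    obtain ⟨b, rfl⟩ := toAlg_surjective R D y
    exact congrArg (toAlg R D) (smul_mul_assoc r a b)

instance : SMulCommClass R (Alg R D) (Alg R D) where
  smul_comm r x y := by
    obtain ⟨a, rfl⟩ := toAlg_surjective R D x
    obtain ⟨b, rfl⟩ := toAlg_surjective R D y
    exact congrArg (toAlg R D) (mul_smul_comm r a b).symm

end Algebra

end GenBoolDynSys

section Morita

variable (R : Type u) [CommRing R]

/-- A unital `A`-`C`-bimodule structure on the `R`-module `M`, for not necessarily unital
`R`-algebras `A` and `C`: commuting associative `R`-bilinear actions with `A M = M = M C`. -/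
structure UnitalBimodule (A C M : Type*) [NonUnitalRing A] [Module R A]
    [NonUnitalRing C] [Module R C] [AddCommGroup M] [Module R M] where
  /-- the left action `a m` -/
  left : A →ₗ[R] M →ₗ[R] M
  /-- the right action `m c` -/
  right : M →ₗ[R] C →ₗ[R] M
  left_mul : ∀ a a' m, left (a * a') m = left a (left a' m)
  right_mul : ∀ m c c', right m (c * c') = right (right m c) c'
  left_right : ∀ a m c, left a (right m c) = right (left a m) c
  left_unital : Submodule.span R {x | ∃ a m, left a m = x} = ⊤
  right_unital : Submodule.span R {x | ∃ m c, right m c = x} = ⊤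

/-- A surjective Morita context `(A, C, P, Q, pq, qp)`: unital bimodules `P` and `Q` with
surjective bimodule maps `P ⊗_C Q → A` and `Q ⊗_A P → C` (given as balanced bilinear maps)
satisfying `(p q) p' = p (q p')` and `(q p) q' = q (p q')`. -/
structure SurjectiveMoritaContext (A C P Q : Type*) [NonUnitalRing A] [Module R A]
    [NonUnitalRing C] [Module R C] [AddCommGroup P] [Module R P] [AddCommGroup Q] [Module R Q] where
  bP : UnitalBimodule R A C P
  bQ : UnitalBimodule R C A Q
  /-- the pairing `P ⊗_C Q → A` -/
  pq : P →ₗ[R] Q →ₗ[R] A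
  /-- the pairing `Q ⊗_A P → C` -/
  qp : Q →ₗ[R] P →ₗ[R] C
  pq_balanced : ∀ p c q, pq (bP.right p c) q = pq p (bQ.left c q)
  pq_left : ∀ a p q, pq (bP.left a p) q = a * pq p q
  pq_right : ∀ p q a, pq p (bQ.right q a) = pq p q * a
  qp_balanced : ∀ q a p, qp (bQ.right q a) p = qp q (bP.left a p)
  qp_left : ∀ c q p, qp (bQ.left c q) p = c * qp q p
  qp_right : ∀ q p c, qp q (bP.right p c) = qp q p * c
  assoc_P : ∀ p q p', bP.left (pq p q) p' = bP.right p (qp q p')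
  assoc_Q : ∀ q p q', bQ.left (qp q p) q' = bQ.right q (pq p q')
  pq_surjective : Submodule.span R {a | ∃ p q, pq p q = a} = ⊤
  qp_surjective : Submodule.span R {c | ∃ q p, qp q p = c} = ⊤

/-- Two (not necessarily unital) `R`-algebras are Morita equivalent if they are connected by a
surjective Morita context. -/
def MoritaEquivalent (A : Type v) (C : Type w) [NonUnitalRing A] [Module R A]
    [NonUnitalRing C] [Module R C] : Prop :=
  ∃ (P Q : Type (max v w)) (_ : AddCommGroup P) (_ : Module R P) (_ : AddCommGroup Q)
    (_ : Module R Q), Nonempty (SurjectiveMoritaContext R A C P Q)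

end Morita

/-! Write S and T for the algebras of the given and of the full system, and φ = `toFull` for the
canonical map S → T. The theorem holds because φ embeds S as a full corner of T.

Corner: T has extra generators s_{α,A}, s*_{α,A} with A outside I_α, but p_C s_{α,A} = s_{α, A ∩
θ_α(C)} and s*_{α,A} p_C = s*_{α, A ∩ θ_α(C)}, and A ∩ θ_α(C) always lies in I_α. Hence φ(S) T φ(S)
⊆ φ(S) (`mul_mem_cornerSubmodule`, `toFull_mul_mem_range`). Fullness: φ(S) contains every p_A, and
each generator of T absorbs some p_A. The bimodules φ(S)T and Tφ(S), paired by the product of T,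
then form the context (`moritaEquivalent_of_full_corner`).

Injectivity of φ is the main difficulty. An element q of Tφ(S) should be determined by its
coordinates p_A q and s*_{α,A} q, which lie in S. The relations prescribe how generators of T act on
such coordinates, so T acts on the abstract families of coordinates with values in S (`fullRep`),
without first knowing that S embeds. On families coming from x in S, φ(a) acts as x ↦ ax. So φ(a) =
0 forces a p_A = 0 and a s_{α,A} = 0, and commuting local units give a = 0. -/

/-! ### Morita contexts from full corners -/

section Corner

variable {R : Type u} [CommRing R] {S T : Type v}
  [NonUnitalRing S] [Module R S]
  [NonUnitalRing T] [Module R T] [IsScalarTower R T T] [SMulCommClass R T T]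

/-- An injective homomorphism whose image is idempotent, is a corner `φ(S) T φ(S) = φ(S)`, and is
full, `T φ(S) T = T`, induces a surjective Morita context between `S` and `T`. -/
theorem moritaEquivalent_of_full_corner (φ : S →ₙₐ[R] T) (hφ : Function.Injective φ)
    (hS : Submodule.span R {x : S | ∃ a b, a * b = x} = ⊤)
    (hcorner : ∀ a c b, ∃ x, φ x = φ a * c * φ b)
    (hfull : Submodule.span R {x : T | ∃ c a d, c * φ a * d = x} = ⊤) :
    MoritaEquivalent R S T := by
  let P : Submodule R T := Submodule.span R {x | ∃ a c, φ a * c = x}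
  let Q : Submodule R T := Submodule.span R {x | ∃ c a, c * φ a = x}
  have hSP : ∀ a, ∀ p : T, φ a * p ∈ P := fun a p => Submodule.subset_span ⟨a, p, rfl⟩
  have hQS : ∀ a, ∀ q : T, q * φ a ∈ Q := fun a q => Submodule.subset_span ⟨q, a, rfl⟩
  have hPT : ∀ p ∈ P, ∀ c, p * c ∈ P := fun p hp c => by
    induction hp using Submodule.span_induction with
    | mem x hx =>
      obtain ⟨a, d, rfl⟩ := hx
      rw [mul_assoc]
      exact hSP _ _
    | zero => rw [zero_mul]; exact P.zero_mem
    | add x y _ _ hx hy => rw [add_mul]; exact P.add_mem hx hy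
    | smul r x _ hx => rw [smul_mul_assoc]; exact P.smul_mem r hx
  have hTQ : ∀ c, ∀ q ∈ Q, c * q ∈ Q := fun c q hq => by
    induction hq using Submodule.span_induction with
    | mem x hx =>
      obtain ⟨d, a, rfl⟩ := hx
      rw [← mul_assoc]
      exact hQS _ _
    | zero => rw [mul_zero]; exact Q.zero_mem
    | add x y _ _ hx hy => rw [mul_add]; exact Q.add_mem hx hy
    | smul r x _ hx => rw [mul_smul_comm]; exact Q.smul_mem r hx
  let φl : S →ₗ[R] T := (φ : S →ₗ[R] T)
  -- The corner hypothesis puts PQ inside φ(S), so that products can be pulled back to S along the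
  -- injective φ.
  have hPQ : ∀ p ∈ P, ∀ q ∈ Q, p * q ∈ LinearMap.range φl := fun p hp q hq => by
    induction hp, hq using Submodule.span_induction₂ with
    | mem_mem x y hx hy =>
      obtain ⟨a, c, rfl⟩ := hx
      obtain ⟨d, b, rfl⟩ := hy
      obtain ⟨z, hz⟩ := hcorner a (c * d) b
      exact ⟨z, hz.trans (by simp only [mul_assoc])⟩
    | zero_left y hy => rw [zero_mul]; exact Submodule.zero_mem _
    | zero_right x hx => rw [mul_zero]; exact Submodule.zero_mem _
    | add_left x y z _ _ _ h₁ h₂ => rw [add_mul]; exact Submodule.add_mem _ h₁ h₂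
    | add_right x y z _ _ _ h₁ h₂ => rw [mul_add]; exact Submodule.add_mem _ h₁ h₂
    | smul_left r x y _ _ h => rw [smul_mul_assoc]; exact Submodule.smul_mem _ r h
    | smul_right r x y _ _ h => rw [mul_smul_comm]; exact Submodule.smul_mem _ r h
  let ψ := (LinearEquiv.ofInjective φl hφ).symm
  have hψ : ∀ y, φ (ψ y) = y.1 := fun y =>
    congrArg Subtype.val ((LinearEquiv.ofInjective φl hφ).apply_symm_apply y)
  have mem_of_span : ∀ {M N : Type v} [AddCommGroup M] [Module R M] [AddCommGroup N]
      [Module R N] (f : M →ₗ[R] N) (X : Set M) (Y : Submodule R N), Submodule.span R X = ⊤ →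
      (∀ x ∈ X, f x ∈ Y) → ∀ x, f x ∈ Y := by
    intro M N _ _ _ _ f X Y hX h x
    have : Submodule.span R X ≤ Y.comap f := Submodule.span_le.2 h
    exact this (hX ▸ Submodule.mem_top)
  -- T need not have a unit, so φ(S) ⊆ φ(S)T relies on S being spanned by products.
  have hφP : ∀ a, φ a ∈ P := mem_of_span φl _ P hS fun _ ⟨a, b, h⟩ => by
    rw [← h]
    exact Submodule.subset_span ⟨a, φ b, (map_mul φ a b).symm⟩
  have hφQ : ∀ a, φ a ∈ Q := mem_of_span φl _ Q hS fun _ ⟨a, b, h⟩ => by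
    rw [← h]
    exact Submodule.subset_span ⟨φ a, b, (map_mul φ a b).symm⟩
  let bP : UnitalBimodule R S T P :=
    { left := LinearMap.mk₂ R (fun a p => ⟨φ a * p.1, hSP a p.1⟩)
        (fun a b p => Subtype.ext (by simp [add_mul]))
        (fun r a p => Subtype.ext (by simp [smul_mul_assoc]))
        (fun a p q => Subtype.ext (by simp [mul_add]))
        (fun r a p => Subtype.ext (by simp [mul_smul_comm]))
      right := LinearMap.mk₂ R (fun p c => ⟨p.1 * c, hPT p.1 p.2 c⟩)
        (fun a b p => Subtype.ext (by simp [add_mul]))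
        (fun r a p => Subtype.ext (by simp [smul_mul_assoc]))
        (fun a p q => Subtype.ext (by simp [mul_add]))
        (fun r a p => Subtype.ext (by simp [mul_smul_comm]))
      left_mul := fun a b m => Subtype.ext (by simp [mul_assoc])
      right_mul := fun m c d => Subtype.ext (by simp [mul_assoc])
      left_right := fun a m c => Subtype.ext (by simp [mul_assoc])
      left_unital := by
        rw [eq_top_iff, ← Submodule.span_span_coe_preimage, Submodule.span_le]
        rintro ⟨_, hx⟩ ⟨a, c, rfl⟩
        refine mem_of_span ((LinearMap.mulRight R c ∘ₗ φl).codRestrict P fun a => hSP a c) _ _ hS ?_ a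
        rintro _ ⟨a, b, rfl⟩
        exact Submodule.subset_span ⟨a, ⟨φ b * c, hSP b c⟩, Subtype.ext <|
          (mul_assoc _ _ _).symm.trans (congrArg (· * c) (map_mul φ a b).symm)⟩
      right_unital := by
        rw [eq_top_iff, ← Submodule.span_span_coe_preimage, Submodule.span_le]
        rintro ⟨_, hx⟩ ⟨a, c, rfl⟩
        -- Fullness expands c into terms c φ(b) d, and φ(a) c φ(b) d = (φ(a) c φ(b)) d lies in PT.
        refine mem_of_span ((LinearMap.mulLeft R (φ a)).codRestrict P (hSP a)) _ _ hfull ?_ c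
        rintro _ ⟨c, b, d, rfl⟩
        exact Submodule.subset_span
          ⟨⟨φ a * (c * φ b), hSP a _⟩, d, Subtype.ext (mul_assoc _ _ _)⟩ }
  let bQ : UnitalBimodule R T S Q :=
    { left := LinearMap.mk₂ R (fun c q => ⟨c * q.1, hTQ c q.1 q.2⟩)
        (fun a b p => Subtype.ext (by simp [add_mul]))
        (fun r a p => Subtype.ext (by simp [smul_mul_assoc]))
        (fun a p q => Subtype.ext (by simp [mul_add]))
        (fun r a p => Subtype.ext (by simp [mul_smul_comm]))
      right := LinearMap.mk₂ R (fun q a => ⟨q.1 * φ a, hQS a q.1⟩)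
        (fun a b p => Subtype.ext (by simp [add_mul]))
        (fun r a p => Subtype.ext (by simp [smul_mul_assoc]))
        (fun a p q => Subtype.ext (by simp [mul_add]))
        (fun r a p => Subtype.ext (by simp [mul_smul_comm]))
      left_mul := fun a b m => Subtype.ext (by simp [mul_assoc])
      right_mul := fun m c d => Subtype.ext (by simp [mul_assoc])
      left_right := fun a m c => Subtype.ext (by simp [mul_assoc])
      left_unital := by
        rw [eq_top_iff, ← Submodule.span_span_coe_preimage, Submodule.span_le]
        rintro ⟨_, hx⟩ ⟨c, a, rfl⟩
        refine mem_of_span ((LinearMap.mulRight R (φ a)).codRestrict Q (hQS a)) _ _ hfull ?_ c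
        rintro _ ⟨c, b, d, rfl⟩
        exact Submodule.subset_span
          ⟨c * φ b, ⟨d * φ a, hQS a d⟩, Subtype.ext (mul_assoc _ _ _).symm⟩
      right_unital := by
        rw [eq_top_iff, ← Submodule.span_span_coe_preimage, Submodule.span_le]
        rintro ⟨_, hx⟩ ⟨c, a, rfl⟩
        refine mem_of_span ((LinearMap.mulLeft R c ∘ₗ φl).codRestrict Q fun a => hQS a c) _ _ hS ?_ a
        rintro _ ⟨a, b, rfl⟩
        exact Submodule.subset_span ⟨⟨c * φ a, hQS a c⟩, b, Subtype.ext <|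
          (mul_assoc _ _ _).trans (congrArg (c * ·) (map_mul φ a b).symm)⟩ }
  let pq : P →ₗ[R] Q →ₗ[R] S := LinearMap.mk₂ R (fun p q => ψ ⟨p.1 * q.1, hPQ _ p.2 _ q.2⟩)
    (fun a b p => hφ (by simp [hψ, add_mul]))
    (fun r a p => hφ (by simp [hψ, smul_mul_assoc]))
    (fun a p q => hφ (by simp [hψ, mul_add]))
    (fun r a p => hφ (by simp [hψ, mul_smul_comm]))
  have hpq : ∀ p q, φ (pq p q) = p.1 * q.1 := fun p q => hψ _
  let qp : Q →ₗ[R] P →ₗ[R] T := LinearMap.mk₂ R (fun q p => q.1 * p.1)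
    (fun a b p => by simp [add_mul])
    (fun r a p => by simp [smul_mul_assoc])
    (fun a p q => by simp [mul_add])
    (fun r a p => by simp [mul_smul_comm])
  exact ⟨P, Q, inferInstance, inferInstance, inferInstance, inferInstance, ⟨
    { bP := bP
      bQ := bQ
      pq := pq
      qp := qp
      pq_balanced := fun p c q => hφ (by rw [hpq, hpq]; exact mul_assoc _ _ _)
      pq_left := fun a p q => hφ (by rw [map_mul, hpq, hpq]; exact mul_assoc _ _ _)
      pq_right := fun p q a => hφ (by rw [map_mul, hpq, hpq]; exact (mul_assoc _ _ _).symm)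
      qp_balanced := fun q a p => mul_assoc _ _ _
      qp_left := fun c q p => mul_assoc _ _ _
      qp_right := fun q p c => (mul_assoc _ _ _).symm
      assoc_P := fun p q p' => Subtype.ext <|
        (congrArg (· * p'.1) (hpq p q)).trans (mul_assoc _ _ _)
      assoc_Q := fun q p q' => Subtype.ext <|
        (mul_assoc _ _ _).trans (congrArg (q.1 * ·) (hpq p q')).symm
      pq_surjective := by
        rw [eq_top_iff, ← hS, Submodule.span_le]
        rintro _ ⟨a, b, rfl⟩
        exact Submodule.subset_span ⟨⟨φ a, hφP a⟩, ⟨φ b, hφQ b⟩, hφ (by rw [hpq, map_mul])⟩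
      qp_surjective := by
        rw [eq_top_iff, ← hfull, Submodule.span_le]
        rintro _ ⟨c, a, d, rfl⟩
        -- Splitting the middle factor into products gives c φ(ab) d = (c φ(a)) (φ(b) d), an element
        -- of QP.
        refine mem_of_span (LinearMap.mulRight R d ∘ₗ LinearMap.mulLeft R c ∘ₗ φl) _ _ hS ?_ a
        rintro _ ⟨a, b, rfl⟩
        exact Submodule.subset_span ⟨⟨c * φ a, hQS a c⟩, ⟨φ b * d, hSP b d⟩,
          by simp [qp, φl, mul_assoc]⟩ }⟩⟩

end Corner

namespace GenBoolDynSys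

variable {B : Type v} {L : Type w} [GeneralizedBooleanAlgebra B]
  (R : Type u) [CommRing R] (D : GenBoolDynSys B L)

/-! ### Generators and relations in the algebra -/

/-- The element `p_A` of the algebra. -/
noncomputable def proj (A : B) : Alg R D := toAlg R D (gen R D (.p A))

/-- The element `s_{α,A}` of the algebra. -/
noncomputable def iso (α : L) (A : B) (hA : A ∈ D.I α) : Alg R D := toAlg R D (gen R D (.s α A hA))

/-- The element `s*_{α,A}` of the algebra. -/
noncomputable def isoStar (α : L) (A : B) (hA : A ∈ D.I α) : Alg R D :=
  toAlg R D (gen R D (.sStar α A hA))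

variable {R D}

theorem toAlg_eq {x y : Free R D} (h : Rel R D x y) : toAlg R D x = toAlg R D y :=
  (RingCon.eq _).2 (RingConGen.Rel.of _ _ ⟨1, x, y, h, (one_smul _ _).symm, (one_smul _ _).symm⟩)

theorem mem_full_I {α : L} {A : B} : A ∈ D.full.I α := trivial

theorem inf_mem_I_left {α : L} {A : B} (hA : A ∈ D.I α) (C : B) : A ⊓ C ∈ D.I α :=
  (D.I α).lower inf_le_left hA

theorem inf_mem_I_right {α : L} {A : B} (hA : A ∈ D.I α) (C : B) : C ⊓ A ∈ D.I α :=
  (D.I α).lower inf_le_right hA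

theorem proj_bot : proj R D ⊥ = 0 := toAlg_eq .p_bot

theorem proj_mul (A C : B) : proj R D A * proj R D C = proj R D (A ⊓ C) :=
  (toAlg_eq (.p_inf A C)).symm

theorem proj_sup (A C : B) :
    proj R D (A ⊔ C) = proj R D A + proj R D C - proj R D (A ⊓ C) := toAlg_eq (.p_sup A C)

theorem iso_mul_proj {α : L} {A : B} (hA : A ∈ D.I α) (C : B) :
    iso R D α A hA * proj R D C = iso R D α (A ⊓ C) (inf_mem_I_left hA C) :=
  toAlg_eq (.s_p α A C hA)

theorem proj_mul_isoStar {α : L} {A : B} (hA : A ∈ D.I α) (C : B) :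
    proj R D C * isoStar R D α A hA = isoStar R D α (A ⊓ C) (inf_mem_I_left hA C) :=
  toAlg_eq (.p_sStar α A C hA)

theorem proj_mul_iso {α : L} {A : B} (hA : A ∈ D.I α) (C : B) :
    proj R D C * iso R D α A hA = iso R D α (A ⊓ D.θ α C) (inf_mem_I_left hA _) :=
  (toAlg_eq (.p_s C α A hA)).trans (iso_mul_proj hA _)

theorem isoStar_mul_proj {α : L} {A : B} (hA : A ∈ D.I α) (C : B) :
    isoStar R D α A hA * proj R D C = isoStar R D α (A ⊓ D.θ α C) (inf_mem_I_left hA _) :=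
  (toAlg_eq (.sStar_p C α A hA)).trans (proj_mul_isoStar hA _)

theorem isoStar_mul_iso {α : L} {A C : B} (hA : A ∈ D.I α) (hC : C ∈ D.I α) :
    isoStar R D α A hA * iso R D α C hC = proj R D (A ⊓ C) := toAlg_eq (.sStar_s α A C hA hC)

theorem isoStar_mul_iso_of_ne {α β : L} (h : α ≠ β) {A C : B} (hA : A ∈ D.I α) (hC : C ∈ D.I β) :
    isoStar R D α A hA * iso R D β C hC = 0 := toAlg_eq (.sStar_s_ne α β h A C hA hC)

theorem toAlg_sum {ι : Type*} (t : Finset ι) (f : ι → Free R D) :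
    toAlg R D (∑ i ∈ t, f i) = ∑ i ∈ t, toAlg R D (f i) := map_sum (toAlgAddHom R D) f t

theorem proj_of_mem_reg {A : B} (hA : A ∈ D.reg) :
    proj R D A = ∑ α ∈ (D.finite_Δ hA).toFinset,
      iso R D α (D.θ α A) (D.θ_mem_I α A) * isoStar R D α (D.θ α A) (D.θ_mem_I α A) :=
  (toAlg_eq (.p_reg A hA)).trans (toAlg_sum _ _)

theorem iso_congr {α : L} {A C : B} (h : A = C) (hA : A ∈ D.I α) (hC : C ∈ D.I α) :
    iso R D α A hA = iso R D α C hC := by subst h; rfl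

theorem isoStar_congr {α : L} {A C : B} (h : A = C) (hA : A ∈ D.I α) (hC : C ∈ D.I α) :
    isoStar R D α A hA = isoStar R D α C hC := by subst h; rfl

/-! ### The induction principles and the universal property -/

/-- Words in the generators span the algebra, and a word grows by prepending one letter. -/
theorem toAlg_induction {Pr : Alg R D → Prop} (gen : ∀ g, Pr (toAlg R D (gen R D g)))
    (add : ∀ x y, Pr x → Pr y → Pr (x + y)) (smul : ∀ (r : R) x, Pr x → Pr (r • x))
    (gen_mul : ∀ g x, Pr x → Pr (toAlg R D (GenBoolDynSys.gen R D g) * x)) (x : Alg R D) :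
    Pr x := by
  have word : ∀ w : FreeSemigroup D.Gen, Pr (toAlg R D (MonoidAlgebra.single w 1)) := fun w =>
    FreeSemigroup.recOnMul w gen fun g w _ ih => by
      have : (MonoidAlgebra.single (FreeSemigroup.of g * w) 1 : Free R D) =
          GenBoolDynSys.gen R D g * MonoidAlgebra.single w 1 := by
        rw [GenBoolDynSys.gen, MonoidAlgebra.single_mul_single, one_mul]
      rw [this]
      exact gen_mul g _ ih
  obtain ⟨y, rfl⟩ := toAlg_surjective R D x
  induction y using MonoidAlgebra.induction_linear with
  | zero =>
    have := smul 0 _ (gen (.p ⊥))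
    rwa [zero_smul] at this
  | add f g hf hg => exact add _ _ hf hg
  | single w r =>
    have : (MonoidAlgebra.single w r : Free R D) = r • MonoidAlgebra.single w 1 := by
      rw [MonoidAlgebra.smul_single, smul_eq_mul, mul_one]
    rw [this]
    exact smul r _ (word w)

/-- An additive property that holds for the generators and for all left multiples of the
generators holds for all elements. -/
theorem toAlg_induction_right {Pr : Alg R D → Prop} (gen : ∀ g, Pr (toAlg R D (gen R D g)))
    (add : ∀ x y, Pr x → Pr y → Pr (x + y)) (smul : ∀ (r : R) x, Pr x → Pr (r • x))
    (mul_gen : ∀ g x, Pr (x * toAlg R D (GenBoolDynSys.gen R D g))) (x : Alg R D) :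
    Pr x := by
  -- The induction peels letters off the left while the hypothesis concerns the last letter, so the
  -- predicate is strengthened to all left multiples.
  refine (toAlg_induction (Pr := fun x => Pr x ∧ ∀ y, Pr (y * x)) (fun g => ⟨gen g, mul_gen g⟩)
    (fun x y hx hy => ⟨add _ _ hx.1 hy.1, fun z => ?_⟩) (fun r x hx => ⟨smul r _ hx.1, fun z => ?_⟩)
    (fun g x hx => ⟨hx.2 _, fun z => ?_⟩) x).1
  · rw [mul_add]
    exact add _ _ (hx.2 z) (hy.2 z)
  · rw [mul_smul_comm]
    exact smul r _ (hx.2 z)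
  · rw [← mul_assoc]
    exact hx.2 _

section Lift

variable {S : Type*} [NonUnitalRing S] [Module R S] [IsScalarTower R S S] [SMulCommClass R S S]

/-- The homomorphism from the free algebra determined by the images of the generators. -/
noncomputable def freeLift (f : D.Gen → S) : Free R D →ₙₐ[R] S :=
  MonoidAlgebra.liftMagma R (FreeSemigroup.lift f)

theorem freeLift_gen (f : D.Gen → S) (g : D.Gen) : freeLift f (gen R D g) = f g := by
  simp [freeLift, gen]

/-- The homomorphism determined by images of the generators that satisfy the relations. -/
noncomputable def lift (f : D.Gen → S)
    (h : ∀ a b, Rel R D a b → freeLift (R := R) f a = freeLift f b) : Alg R D →ₙₐ[R] S where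
  toFun := Quotient.lift (s := (con R D).toSetoid) (freeLift f) fun x y hxy => by
    have h' : RingConGen.Rel (fun x y => ∃ (r : R) (a b : Free R D), Rel R D a b ∧
      x = r • a ∧ y = r • b) x y := hxy
    clear hxy
    induction h' with
    | of x y hxy =>
      obtain ⟨t, a, b, hab, rfl, rfl⟩ := hxy
      rw [map_smul, map_smul, h _ _ hab]
    | refl x => rfl
    | symm _ ih => exact ih.symm
    | trans _ _ ih₁ ih₂ => exact ih₁.trans ih₂
    | add _ _ ih₁ ih₂ => rw [map_add, map_add, ih₁, ih₂]
    | mul _ _ ih₁ ih₂ => rw [map_mul, map_mul, ih₁, ih₂]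
  map_smul' r x := by
    obtain ⟨a, rfl⟩ := toAlg_surjective R D x
    exact map_smul (freeLift f) r a
  map_zero' := map_zero (freeLift f)
  map_add' x y := by
    obtain ⟨a, rfl⟩ := toAlg_surjective R D x
    obtain ⟨b, rfl⟩ := toAlg_surjective R D y
    exact map_add (freeLift f) a b
  map_mul' x y := by
    obtain ⟨a, rfl⟩ := toAlg_surjective R D x
    obtain ⟨b, rfl⟩ := toAlg_surjective R D y
    exact map_mul (freeLift f) a b

theorem lift_gen (f : D.Gen → S)
    (h : ∀ a b, Rel R D a b → freeLift (R := R) f a = freeLift f b) (g : D.Gen) :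
    lift f h (toAlg R D (gen R D g)) = f g := freeLift_gen f g

end Lift

/-! ### The homomorphism to the algebra of the full system -/

variable (R D)

/-- The inclusion of the generators of a system into those of the full system. -/
noncomputable def genToFull : D.Gen → Alg R D.full
  | .p A => proj R D.full A
  | .s α A _ => iso R D.full α A mem_full_I
  | .sStar α A _ => isoStar R D.full α A mem_full_I

/-- The canonical homomorphism to the algebra of the full system. -/
noncomputable def toFull : Alg R D →ₙₐ[R] Alg R D.full :=
  lift (genToFull R D) fun a b hab => by
    cases hab with
    | p_bot => rw [freeLift_gen, map_zero]; exact proj_bot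
    | p_inf A C => simp only [map_mul, freeLift_gen]; exact (proj_mul A C).symm
    | p_sup A C => simp only [map_sub, map_add, freeLift_gen]; exact proj_sup A C
    | p_s A α C hC =>
      simp only [map_mul, freeLift_gen]
      exact toAlg_eq (.p_s (D := D.full) A α C mem_full_I)
    | sStar_p A α C hC =>
      simp only [map_mul, freeLift_gen]
      exact toAlg_eq (.sStar_p (D := D.full) A α C mem_full_I)
    | sStar_s α A C hA hC =>
      simp only [map_mul, freeLift_gen]
      exact toAlg_eq (.sStar_s (D := D.full) α A C mem_full_I mem_full_I)
    | sStar_s_ne α β h A C hA hC =>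
      simp only [map_mul, map_zero, freeLift_gen]
      exact toAlg_eq (.sStar_s_ne (D := D.full) α β h A C mem_full_I mem_full_I)
    | s_p α A C hA =>
      simp only [map_mul, freeLift_gen]
      exact toAlg_eq (.s_p (D := D.full) α A C mem_full_I)
    | p_sStar α A C hA =>
      simp only [map_mul, freeLift_gen]
      exact toAlg_eq (.p_sStar (D := D.full) α A C mem_full_I)
    | p_reg A hA =>
      simp only [map_sum, map_mul, freeLift_gen]
      -- Regularity and Δ depend on θ alone, so both systems impose the same relation here.
      exact proj_of_mem_reg (D := D.full) hA

variable {R D}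

theorem toFull_proj (A : B) : toFull R D (proj R D A) = proj R D.full A := lift_gen _ _ _

theorem toFull_iso {α : L} {A : B} (hA : A ∈ D.I α) :
    toFull R D (iso R D α A hA) = iso R D.full α A mem_full_I := lift_gen _ _ _

theorem toFull_isoStar {α : L} {A : B} (hA : A ∈ D.I α) :
    toFull R D (isoStar R D α A hA) = isoStar R D.full α A mem_full_I := lift_gen _ _ _

end GenBoolDynSys

/-! ### Commuting local units -/

/-- If an element `x` is a sum of elements each fixed by one of a family of commuting
endomorphisms, and every member of the family kills `x`, then `x = 0`. -/
theorem eq_zero_of_mem_span_fixed {R M : Type*} [CommRing R] [AddCommGroup M] [Module R M]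
    (E : Set (Module.End R M)) (hE : ∀ e ∈ E, ∀ f ∈ E, e * f = f * e) {x : M}
    (hx : x ∈ Submodule.span R {y | ∃ e ∈ E, e y = y}) (h : ∀ e ∈ E, e x = 0) : x = 0 := by
  -- Some product of complements 1 - e kills x, one factor per summand; yet each complement fixes x
  -- because e x = 0.
  let N : Set (Module.End R M) := {f | ∃ e ∈ E, f = 1 - e}
  have hN : ∀ f ∈ N, ∀ g ∈ N, f * g = g * f := by
    rintro _ ⟨e, he, rfl⟩ _ ⟨f, hf, rfl⟩
    simp only [mul_sub, sub_mul, one_mul, mul_one, hE e he f hf]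
    abel
  have hcomm : ∀ f ∈ Submonoid.closure N, ∀ g ∈ Submonoid.closure N, f * g = g * f := by
    intro f hf g hg
    have := Submonoid.isMulCommutative_closure (Module.End R M) hN
    exact congrArg Subtype.val
      (this.is_comm.comm (⟨f, hf⟩ : Submonoid.closure N) ⟨g, hg⟩)
  have hkill : ∃ f ∈ Submonoid.closure N, f x = 0 := by
    clear h
    induction hx using Submodule.span_induction with
    | mem y hy =>
      obtain ⟨e, he, hy⟩ := hy
      exact ⟨1 - e, Submonoid.subset_closure ⟨e, he, rfl⟩, by simp [hy]⟩
    | zero => exact ⟨1, Submonoid.one_mem _, map_zero _⟩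
    | add y z _ _ hy hz =>
      obtain ⟨f, hf, hfy⟩ := hy
      obtain ⟨g, hg, hgz⟩ := hz
      refine ⟨f * g, Submonoid.mul_mem _ hf hg, ?_⟩
      have h₁ : (f * g) z = 0 := by rw [Module.End.mul_apply, hgz, map_zero]
      have h₂ : (f * g) y = 0 := by
        rw [hcomm f hf g hg, Module.End.mul_apply, hfy, map_zero]
      rw [map_add, h₁, h₂, add_zero]
    | smul r y _ hy =>
      obtain ⟨f, hf, hfy⟩ := hy
      exact ⟨f, hf, by rw [map_smul, hfy, smul_zero]⟩
  obtain ⟨f, hf, hfx⟩ := hkill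
  have hfix : f x = x := by
    clear hfx
    induction hf using Submonoid.closure_induction with
    | mem f hf =>
      obtain ⟨e, he, rfl⟩ := hf
      simp [h e he]
    | one => rfl
    | mul f g _ _ hf hg => rw [Module.End.mul_apply, hg, hf]
  rw [← hfix, hfx]

namespace GenBoolDynSys

variable {B : Type v} {L : Type w} [GeneralizedBooleanAlgebra B]
  {R : Type u} [CommRing R] {D : GenBoolDynSys B L}

theorem iso_mul_proj_self {α : L} {A : B} (hA : A ∈ D.I α) :
    iso R D α A hA * proj R D A = iso R D α A hA := by
  rw [iso_mul_proj]
  exact iso_congr (inf_idem A) _ _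

theorem proj_mul_isoStar_self {α : L} {A : B} (hA : A ∈ D.I α) :
    proj R D A * isoStar R D α A hA = isoStar R D α A hA := by
  rw [proj_mul_isoStar]
  exact isoStar_congr (inf_idem A) _ _

theorem proj_mul_self (A : B) : proj R D A * proj R D A = proj R D A := by
  rw [proj_mul, inf_idem]

variable (R D)

/-- The idempotents `p_A` and `s_{α,A} s*_{α,A}`. -/
def localUnits : Set (Alg R D) :=
  {e | (∃ A, e = proj R D A) ∨ ∃ α A hA, e = iso R D α A hA * isoStar R D α A hA}

variable {R D}

/-- Both orders of a product reduce to one normal form: p_A with s_{α,C} s*_{α,C} gives s_{α,C}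
p_{θ_α(A)} s*_{α,C}, while two range idempotents give that of the intersection, or 0 for different
letters. -/
theorem localUnits_comm (e : Alg R D) (he : e ∈ localUnits R D) (f : Alg R D)
    (hf : f ∈ localUnits R D) : e * f = f * e := by
  have key : ∀ (A : B) (α : L) (C : B) (hC : C ∈ D.I α),
      proj R D A * (iso R D α C hC * isoStar R D α C hC) =
        iso R D α C hC * isoStar R D α C hC * proj R D A := fun A α C hC => by
    rw [← mul_assoc, proj_mul_iso, ← iso_mul_proj, mul_assoc, mul_assoc, isoStar_mul_proj,
      proj_mul_isoStar]
  rcases he with ⟨A, rfl⟩ | ⟨α, A, hA, rfl⟩ <;> rcases hf with ⟨C, rfl⟩ | ⟨β, C, hC, rfl⟩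
  · rw [proj_mul, proj_mul, inf_comm]
  · exact key _ _ _ _
  · exact (key _ _ _ _).symm
  · by_cases h : α = β
    · subst h
      have h2 : ∀ (A C : B) (hA : A ∈ D.I α) (hC : C ∈ D.I α),
          iso R D α A hA * isoStar R D α A hA * (iso R D α C hC * isoStar R D α C hC) =
          iso R D α (A ⊓ C) (inf_mem_I_left hA C) *
            isoStar R D α (A ⊓ C) (inf_mem_I_left hA C) := fun A C hA hC => by
        rw [mul_assoc, ← mul_assoc (isoStar R D α A hA), isoStar_mul_iso, ← mul_assoc,
          iso_mul_proj, ← iso_mul_proj_self, mul_assoc, proj_mul_isoStar]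
        exact congrArg₂ _ (iso_congr (inf_left_idem _ _) _ _)
          (isoStar_congr (by rw [inf_left_idem, inf_left_comm, inf_idem]) _ _)
      rw [h2, h2]
      exact congrArg₂ _ (iso_congr (inf_comm _ _) _ _) (isoStar_congr (inf_comm _ _) _ _)
    · have h2 : ∀ (α β : L) (_ : α ≠ β) (A C : B) (hA : A ∈ D.I α) (hC : C ∈ D.I β),
          iso R D α A hA * isoStar R D α A hA * (iso R D β C hC * isoStar R D β C hC) = 0 :=
        fun α β h A C hA hC => by
          rw [mul_assoc, ← mul_assoc (isoStar R D α A hA), isoStar_mul_iso_of_ne h, zero_mul,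
            mul_zero]
      rw [h2 α β h, h2 β α (Ne.symm h)]

theorem exists_localUnit_mul_gen (g : D.Gen) :
    ∃ e ∈ localUnits R D, e * toAlg R D (gen R D g) = toAlg R D (gen R D g) := by
  cases g with
  | p A => exact ⟨_, .inl ⟨A, rfl⟩, proj_mul_self A⟩
  | s α A hA =>
    refine ⟨_, .inr ⟨α, A, hA, rfl⟩, ?_⟩
    change _ * iso R D α A hA = iso R D α A hA
    rw [mul_assoc, isoStar_mul_iso, inf_idem, iso_mul_proj_self]
  | sStar α A hA => exact ⟨_, .inl ⟨A, rfl⟩, proj_mul_isoStar_self hA⟩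

theorem exists_gen_mul_localUnit (g : D.Gen) :
    ∃ e ∈ localUnits R D, toAlg R D (gen R D g) * e = toAlg R D (gen R D g) := by
  cases g with
  | p A => exact ⟨_, .inl ⟨A, rfl⟩, proj_mul_self A⟩
  | s α A hA => exact ⟨_, .inl ⟨A, rfl⟩, iso_mul_proj_self hA⟩
  | sStar α A hA =>
    refine ⟨_, .inr ⟨α, A, hA, rfl⟩, ?_⟩
    change isoStar R D α A hA * _ = isoStar R D α A hA
    rw [← mul_assoc, isoStar_mul_iso, inf_idem, proj_mul_isoStar_self]

/-- An element killed on the left by all `p_A` and all `s*_{α,A}` is zero. -/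
theorem eq_zero_of_left {x : Alg R D} (hp : ∀ A, proj R D A * x = 0)
    (hs : ∀ α A hA, isoStar R D α A hA * x = 0) : x = 0 := by
  refine eq_zero_of_mem_span_fixed (LinearMap.mulLeft R '' localUnits R D) ?_ ?_ ?_
  · rintro _ ⟨e, he, rfl⟩ _ ⟨f, hf, rfl⟩
    ext y
    change e * (f * y) = f * (e * y)
    rw [← mul_assoc, localUnits_comm e he f hf, mul_assoc]
  · clear hp hs
    refine toAlg_induction (fun g => ?_) (fun _ _ => Submodule.add_mem _)
      (fun r _ => Submodule.smul_mem _ r)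
      (fun g x _ => ?_) x
    · obtain ⟨e, he, h⟩ := exists_localUnit_mul_gen (R := R) g
      exact Submodule.subset_span ⟨_, ⟨e, he, rfl⟩, h⟩
    · obtain ⟨e, he, h⟩ := exists_localUnit_mul_gen (R := R) g
      exact Submodule.subset_span ⟨_, ⟨e, he, rfl⟩,
        (mul_assoc _ _ _).symm.trans (congrArg (· * x) h)⟩
  · rintro _ ⟨_, ⟨A, rfl⟩ | ⟨α, A, hA, rfl⟩, rfl⟩
    · exact hp A
    · exact (mul_assoc _ _ _).trans (by rw [hs, mul_zero])

/-- An element killed on the right by all `p_A` and all `s_{α,A}` is zero. -/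
theorem eq_zero_of_right {x : Alg R D} (hp : ∀ A, x * proj R D A = 0)
    (hs : ∀ α A hA, x * iso R D α A hA = 0) : x = 0 := by
  refine eq_zero_of_mem_span_fixed (LinearMap.mulRight R '' localUnits R D) ?_ ?_ ?_
  · rintro _ ⟨e, he, rfl⟩ _ ⟨f, hf, rfl⟩
    ext y
    change y * f * e = y * e * f
    rw [mul_assoc, localUnits_comm f hf e he, mul_assoc]
  · clear hp hs
    refine toAlg_induction_right (fun g => ?_) (fun _ _ => Submodule.add_mem _)
      (fun r _ => Submodule.smul_mem _ r)
      (fun g x => ?_) x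
    · obtain ⟨e, he, h⟩ := exists_gen_mul_localUnit (R := R) g
      exact Submodule.subset_span ⟨_, ⟨e, he, rfl⟩, h⟩
    · obtain ⟨e, he, h⟩ := exists_gen_mul_localUnit (R := R) g
      exact Submodule.subset_span ⟨_, ⟨e, he, rfl⟩,
        (mul_assoc _ _ _).trans (congrArg (x * ·) h)⟩
  · rintro _ ⟨_, ⟨A, rfl⟩ | ⟨α, A, hA, rfl⟩, rfl⟩
    · exact hp A
    · exact (mul_assoc _ _ _).symm.trans (by rw [hs, zero_mul])

end GenBoolDynSys

namespace GenBoolDynSys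

variable {B : Type v} {L : Type w} [GeneralizedBooleanAlgebra B]
  (R : Type u) [CommRing R] (D : GenBoolDynSys B L)

/-! ### A representation of the algebra of the full system -/

/-- Intersecting with θ_α(C) brings any label into I_α; this is what lets arbitrary labels of the
full system act through the smaller algebra. -/
theorem inf_θ_mem_I {D : GenBoolDynSys B L} (α : L) (A C : B) : A ⊓ D.θ α C ∈ D.I α :=
  D.mem_I_of_le α _ C inf_le_right

theorem θ_inf_mem_I {D : GenBoolDynSys B L} (α : L) (A C : B) : D.θ α C ⊓ A ∈ D.I α :=
  D.mem_I_of_le α _ C inf_le_left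

/-- The `R`-module of compatible families `(f_A, g_{α,A})` in the algebra, which behave like the
families `(p_A q, s*_{α,A} q)` for an element `q` of a module over the algebra of the full
system. -/
def families : Submodule R ((B → Alg R D) × (L → B → Alg R D)) where
  carrier := {v | (∀ A C, v.1 (A ⊓ C) = proj R D A * v.1 C) ∧
    (∀ α A C, v.2 α (A ⊓ C) = proj R D A * v.2 α C) ∧
    ∀ α A hA C, isoStar R D α A hA * v.1 C = v.2 α (A ⊓ D.θ α C)}
  zero_mem' := ⟨fun _ _ => (mul_zero _).symm, fun _ _ _ => (mul_zero _).symm,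
    fun _ _ _ _ => mul_zero _⟩
  add_mem' := fun {v v'} h h' => ⟨fun A C => by simp [mul_add, h.1 A C, h'.1 A C],
    fun α A C => by simp [mul_add, h.2.1 α A C, h'.2.1 α A C],
    fun α A hA C => by simp [mul_add, h.2.2 α A hA C, h'.2.2 α A hA C]⟩
  smul_mem' := fun r v h => ⟨fun A C => by simp [mul_smul_comm, h.1 A C],
    fun α A C => by simp [mul_smul_comm, h.2.1 α A C],
    fun α A hA C => by simp [mul_smul_comm, h.2.2 α A hA C]⟩

theorem iso_bot {D : GenBoolDynSys B L} (α : L) : iso R D α ⊥ (D.I α).bot_mem = 0 := by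
  rw [← iso_mul_proj_self, proj_bot, mul_zero]

namespace families

variable {R D}

theorem fst_inf (v : families R D) (A C : B) : v.1.1 (A ⊓ C) = proj R D A * v.1.1 C := v.2.1 A C

theorem snd_inf (v : families R D) (α : L) (A C : B) :
    v.1.2 α (A ⊓ C) = proj R D A * v.1.2 α C := v.2.2.1 α A C

theorem isoStar_mul_fst (v : families R D) {α : L} {A : B} (hA : A ∈ D.I α) (C : B) :
    isoStar R D α A hA * v.1.1 C = v.1.2 α (A ⊓ D.θ α C) := v.2.2.2 α A hA C

theorem fst_bot (v : families R D) : v.1.1 ⊥ = 0 := by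
  rw [← inf_idem ⊥, fst_inf, proj_bot, zero_mul]

theorem snd_bot (v : families R D) (α : L) : v.1.2 α ⊥ = 0 := by
  rw [← inf_idem ⊥, snd_inf, proj_bot, zero_mul]

theorem proj_mul_fst_self (v : families R D) (A : B) : proj R D A * v.1.1 A = v.1.1 A := by
  rw [← fst_inf, inf_idem]

theorem proj_mul_snd_self (v : families R D) (α : L) (A : B) :
    proj R D A * v.1.2 α A = v.1.2 α A := by
  rw [← snd_inf, inf_idem]

theorem fst_sup (v : families R D) (A C : B) :
    v.1.1 (A ⊔ C) = v.1.1 A + v.1.1 C - v.1.1 (A ⊓ C) := by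
  rw [← proj_mul_fst_self v (A ⊔ C), proj_sup, sub_mul, add_mul, ← fst_inf, ← fst_inf, ← fst_inf,
    inf_sup_self, inf_eq_left.2 (le_sup_right : C ≤ A ⊔ C),
    inf_eq_left.2 (inf_le_sup : A ⊓ C ≤ A ⊔ C)]

theorem snd_sup (v : families R D) (α : L) (A C : B) :
    v.1.2 α (A ⊔ C) = v.1.2 α A + v.1.2 α C - v.1.2 α (A ⊓ C) := by
  rw [← proj_mul_snd_self v α (A ⊔ C), proj_sup, sub_mul, add_mul, ← snd_inf, ← snd_inf, ← snd_inf,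
    inf_sup_self, inf_eq_left.2 (le_sup_right : C ≤ A ⊔ C),
    inf_eq_left.2 (inf_le_sup : A ⊓ C ≤ A ⊔ C)]

theorem ext {v v' : families R D} (h₁ : ∀ A, v.1.1 A = v'.1.1 A)
    (h₂ : ∀ α A, v.1.2 α A = v'.1.2 α A) : v = v' :=
  Subtype.ext (Prod.ext (funext h₁) (funext fun α => funext (h₂ α)))

variable (R D)

/-- The action of `p_C` on compatible families. -/
noncomputable def projEnd (C : B) : Module.End R (families R D) where
  toFun v := ⟨(fun A => v.1.1 (A ⊓ C), fun α A => v.1.2 α (A ⊓ D.θ α C)),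
    fun A A' => by simp only [inf_assoc, fst_inf v A],
    fun α A A' => by simp only [inf_assoc, snd_inf v α A],
    fun α A hA A' => by simp only [isoStar_mul_fst, D.θ_inf, inf_assoc]⟩
  map_add' _ _ := rfl
  map_smul' _ _ := rfl

open Classical in
/-- The action of `s_{α,Y}` on compatible families. -/
noncomputable def isoEnd (α : L) (Y : B) : Module.End R (families R D) where
  -- Modelled on p_A s_{α,Y} q = s_{α, θ_α(A) ∩ Y} p_Y q and s*_{β,A} s_{α,Y} q = δ_{α,β} p_{A ∩ Y}
  -- q. The label θ_α(A) ∩ Y is in I_α even when Y is not.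
  toFun v := ⟨(fun A => iso R D α (D.θ α A ⊓ Y) (θ_inf_mem_I α Y A) * v.1.1 Y,
      fun β A => if α = β then v.1.1 (A ⊓ Y) else 0),
    fun A A' => by
      dsimp only
      rw [← mul_assoc, proj_mul_iso]
      congr 1
      exact iso_congr (by rw [D.θ_inf, inf_assoc, inf_comm]) _ _,
    fun β A A' => by
      by_cases h : α = β
      · simp only [if_pos h, inf_assoc, fst_inf v A]
      · simp only [if_neg h, mul_zero],
    fun β A hA A' => by
      by_cases h : α = β
      · subst h
        rw [← mul_assoc, isoStar_mul_iso, ← fst_inf]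
        simp only [if_true, inf_assoc, inf_idem]
      · simp only [if_neg h]
        rw [← mul_assoc, isoStar_mul_iso_of_ne (Ne.symm h), zero_mul]⟩
  map_add' v v' := ext (fun A => mul_add _ _ _) fun β A => by
    by_cases h : α = β <;> simp [h]
  map_smul' r v := ext
    (fun A => mul_smul_comm r (iso R D α _ (θ_inf_mem_I α Y A)) (v.1.1 Y)) fun β A => by
    by_cases h : α = β <;> simp [h]

/-- The action of `s*_{α,Y}` on compatible families. -/
noncomputable def isoStarEnd (α : L) (Y : B) : Module.End R (families R D) where
  -- Modelled on p_A s*_{α,Y} q = s*_{α, A ∩ Y} q and s*_{β,A} s*_{α,Y} q = s*_{β, A ∩ θ_β(Y)}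
  -- s*_{α,Y} q.
  toFun v := ⟨(fun A => v.1.2 α (A ⊓ Y),
      fun β A => isoStar R D β (A ⊓ D.θ β Y) (inf_θ_mem_I β A Y) * v.1.2 α Y),
    fun A A' => by simp only [inf_assoc, snd_inf v α A],
    fun β A A' => by
      dsimp only
      rw [← mul_assoc, proj_mul_isoStar]
      congr 1
      exact isoStar_congr (by rw [inf_assoc, inf_comm]) _ _,
    fun β A hA A' => by
      simp only [snd_inf v α A']
      rw [← mul_assoc, isoStar_mul_proj]
      -- The coordinate at Y absorbs p_Y, which supplies the missing factor θ_β(Y) in the label.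
      nth_rewrite 1 [← proj_mul_snd_self v α Y]
      rw [← mul_assoc, isoStar_mul_proj]⟩
  map_add' v v' := ext (fun A => rfl) fun β A => mul_add _ _ _
  map_smul' r v := ext (fun A => rfl) fun β A =>
    mul_smul_comm r (isoStar R D β _ (inf_θ_mem_I β A Y)) (v.1.2 α Y)

variable {R D}

theorem projEnd_fst (C : B) (v : families R D) (A : B) :
    (projEnd R D C v).1.1 A = v.1.1 (A ⊓ C) := rfl

theorem projEnd_snd (C : B) (v : families R D) (α : L) (A : B) :
    (projEnd R D C v).1.2 α A = v.1.2 α (A ⊓ D.θ α C) := rfl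

theorem isoEnd_fst (α : L) (Y : B) (v : families R D) (A : B) :
    (isoEnd R D α Y v).1.1 A = iso R D α (D.θ α A ⊓ Y) (θ_inf_mem_I α Y A) * v.1.1 Y := rfl

theorem isoEnd_snd (α : L) (Y : B) (v : families R D) (A : B) :
    (isoEnd R D α Y v).1.2 α A = v.1.1 (A ⊓ Y) := if_pos rfl

theorem isoEnd_snd_of_ne {α β : L} (h : α ≠ β) (Y : B) (v : families R D) (A : B) :
    (isoEnd R D α Y v).1.2 β A = 0 := if_neg h

theorem isoStarEnd_fst (α : L) (Y : B) (v : families R D) (A : B) :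
    (isoStarEnd R D α Y v).1.1 A = v.1.2 α (A ⊓ Y) := rfl

theorem isoStarEnd_snd (α β : L) (Y : B) (v : families R D) (A : B) :
    (isoStarEnd R D α Y v).1.2 β A =
      isoStar R D β (A ⊓ D.θ β Y) (inf_θ_mem_I β A Y) * v.1.2 α Y := rfl

theorem projEnd_bot : projEnd R D ⊥ = 0 := LinearMap.ext fun v => ext
  (fun A => by rw [projEnd_fst, inf_bot_eq, fst_bot]; rfl)
  (fun α A => by rw [projEnd_snd, D.θ_bot, inf_bot_eq, snd_bot]; rfl)

theorem projEnd_inf (A C : B) : projEnd R D (A ⊓ C) = projEnd R D A * projEnd R D C :=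
  LinearMap.ext fun v => ext
    (fun X => by rw [Module.End.mul_apply]; simp only [projEnd_fst, inf_assoc])
    (fun α X => by rw [Module.End.mul_apply]; simp only [projEnd_snd, inf_assoc, D.θ_inf])

theorem projEnd_sup (A C : B) :
    projEnd R D (A ⊔ C) = projEnd R D A + projEnd R D C - projEnd R D (A ⊓ C) :=
  LinearMap.ext fun v => ext
    (fun X => by
      change v.1.1 (X ⊓ (A ⊔ C)) = v.1.1 (X ⊓ A) + v.1.1 (X ⊓ C) - v.1.1 (X ⊓ (A ⊓ C))
      rw [inf_sup_left, fst_sup, ← inf_inf_distrib_left])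
    (fun α X => by
      change v.1.2 α (X ⊓ D.θ α (A ⊔ C)) = v.1.2 α (X ⊓ D.θ α A) + v.1.2 α (X ⊓ D.θ α C) -
        v.1.2 α (X ⊓ D.θ α (A ⊓ C))
      rw [D.θ_sup, D.θ_inf, inf_sup_left, snd_sup, ← inf_inf_distrib_left])

theorem projEnd_mul_isoEnd (A : B) (α : L) (C : B) :
    projEnd R D A * isoEnd R D α C = isoEnd R D α C * projEnd R D (D.θ α A) :=
  LinearMap.ext fun v => ext
    (fun X => by
      rw [Module.End.mul_apply, Module.End.mul_apply, projEnd_fst, isoEnd_fst, isoEnd_fst,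
        projEnd_fst, inf_comm C (D.θ α A), fst_inf, ← mul_assoc, iso_mul_proj]
      congr 1
      exact iso_congr (by rw [D.θ_inf, inf_right_comm]) _ _)
    (fun β X => by
      rw [Module.End.mul_apply, Module.End.mul_apply, projEnd_snd]
      by_cases h : α = β
      · subst h
        rw [isoEnd_snd, isoEnd_snd, projEnd_fst, inf_right_comm]
      · rw [isoEnd_snd_of_ne h, isoEnd_snd_of_ne h])

theorem isoStarEnd_mul_projEnd (A : B) (α : L) (C : B) :
    isoStarEnd R D α C * projEnd R D A = projEnd R D (D.θ α A) * isoStarEnd R D α C :=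
  LinearMap.ext fun v => ext
    (fun X => by
      rw [Module.End.mul_apply, Module.End.mul_apply, projEnd_fst, isoStarEnd_fst, isoStarEnd_fst,
        projEnd_snd, inf_right_comm])
    (fun β X => by
      rw [Module.End.mul_apply, Module.End.mul_apply, projEnd_snd, isoStarEnd_snd,
        isoStarEnd_snd, projEnd_snd, inf_comm C (D.θ α A), snd_inf, ← mul_assoc, isoStar_mul_proj]
      congr 1
      exact isoStar_congr (by rw [inf_right_comm]) _ _)

theorem isoStarEnd_mul_isoEnd (α : L) (A C : B) :
    isoStarEnd R D α A * isoEnd R D α C = projEnd R D (A ⊓ C) :=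
  LinearMap.ext fun v => ext
    (fun X => by
      rw [Module.End.mul_apply, projEnd_fst, isoStarEnd_fst, isoEnd_snd, inf_assoc])
    (fun β X => by
      rw [Module.End.mul_apply, projEnd_snd, isoStarEnd_snd, isoEnd_snd, isoStar_mul_fst, D.θ_inf,
        inf_assoc, inf_left_idem])

theorem isoStarEnd_mul_isoEnd_of_ne {α β : L} (h : α ≠ β) (A C : B) :
    isoStarEnd R D α A * isoEnd R D β C = 0 :=
  LinearMap.ext fun v => ext
    (fun X => by
      rw [Module.End.mul_apply, isoStarEnd_fst, isoEnd_snd_of_ne (Ne.symm h)]; rfl)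
    (fun γ X => by
      rw [Module.End.mul_apply, isoStarEnd_snd, isoEnd_snd_of_ne (Ne.symm h), mul_zero]; rfl)

theorem isoEnd_mul_projEnd (α : L) (A C : B) :
    isoEnd R D α A * projEnd R D C = isoEnd R D α (A ⊓ C) :=
  LinearMap.ext fun v => ext
    (fun X => by
      rw [Module.End.mul_apply, isoEnd_fst, isoEnd_fst, projEnd_fst,
        ← proj_mul_fst_self v (A ⊓ C), ← mul_assoc, ← mul_assoc, iso_mul_proj, iso_mul_proj]
      congr 1
      exact iso_congr (by simp only [inf_assoc, inf_left_idem, inf_idem]) _ _)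
    (fun β X => by
      rw [Module.End.mul_apply]
      by_cases h : α = β
      · subst h
        rw [isoEnd_snd, isoEnd_snd, projEnd_fst, inf_assoc]
      · rw [isoEnd_snd_of_ne h, isoEnd_snd_of_ne h])

theorem projEnd_mul_isoStarEnd (α : L) (A C : B) :
    projEnd R D C * isoStarEnd R D α A = isoStarEnd R D α (A ⊓ C) :=
  LinearMap.ext fun v => ext
    (fun X => by
      rw [Module.End.mul_apply, projEnd_fst, isoStarEnd_fst, isoStarEnd_fst, inf_comm A C,
        inf_assoc])
    (fun β X => by
      rw [Module.End.mul_apply, projEnd_snd, isoStarEnd_snd, isoStarEnd_snd, inf_comm A C,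
        snd_inf, ← mul_assoc, isoStar_mul_proj]
      congr 1
      exact isoStar_congr (by
        rw [D.θ_inf, inf_right_comm X, inf_assoc X, inf_comm (D.θ β A), inf_assoc X,
          inf_right_comm (D.θ β C), inf_idem]) _ _)

/-- In the first coordinate at X this is the regular relation of the smaller algebra for X ∩ A,
which is again regular; letters of Δ_A outside Δ_{X ∩ A} contribute s_{α,∅} = 0. In the second
coordinate at β only the summand α = β survives, and for β outside Δ_A both sides vanish. -/
theorem projEnd_of_mem_reg {A : B} (hA : A ∈ D.reg) :
    projEnd R D A = ∑ α ∈ (D.finite_Δ hA).toFinset,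
      isoEnd R D α (D.θ α A) * isoStarEnd R D α (D.θ α A) := by
  refine LinearMap.ext fun v => ext (fun X => ?_) fun β X => ?_
  · simp only [LinearMap.sum_apply, Submodule.coe_sum, Prod.fst_sum, Finset.sum_apply]
    have hX : X ⊓ A ∈ D.reg := fun C hC => hA C (hC.trans inf_le_right)
    rw [projEnd_fst, ← proj_mul_fst_self, proj_of_mem_reg hX, Finset.sum_mul]
    have hsub : (D.finite_Δ hX).toFinset ⊆ (D.finite_Δ hA).toFinset := by
      intro α hα
      simp only [Set.Finite.mem_toFinset, Δ, Set.mem_ofPred_eq] at hα ⊢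
      intro h
      exact hα (by rw [D.θ_inf, h, inf_bot_eq])
    rw [← Finset.sum_subset hsub]
    · refine Finset.sum_congr rfl fun α _ => ?_
      rw [mul_assoc, isoStar_mul_fst, inf_idem, Module.End.mul_apply, isoEnd_fst, isoStarEnd_fst,
        inf_idem, iso_congr (D.θ_inf α X A) _ (θ_inf_mem_I α _ X), D.θ_inf, snd_inf, ← mul_assoc,
        iso_mul_proj]
      congr 1
      exact iso_congr (by rw [inf_right_comm, inf_idem]) _ _
    · intro α _ hα
      simp only [Set.Finite.mem_toFinset, Δ, Set.mem_ofPred_eq, not_not, D.θ_inf] at hα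
      rw [Module.End.mul_apply, isoEnd_fst, iso_congr hα _ (D.I α).bot_mem, iso_bot, zero_mul]
  · simp only [LinearMap.sum_apply, Submodule.coe_sum, Prod.snd_sum, Finset.sum_apply]
    rw [projEnd_snd, Finset.sum_eq_single β]
    · rw [Module.End.mul_apply, isoEnd_snd, isoStarEnd_fst, inf_assoc, inf_idem]
    · intro α _ h
      rw [Module.End.mul_apply, isoEnd_snd_of_ne h]
    · intro h
      simp only [Set.Finite.mem_toFinset, Δ, Set.mem_ofPred_eq, not_not] at h
      rw [Module.End.mul_apply, isoEnd_snd, h, inf_bot_eq, fst_bot]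

end families
end GenBoolDynSys

/-! ### Injectivity of the canonical homomorphism -/

namespace GenBoolDynSys

variable {B : Type v} {L : Type w} [GeneralizedBooleanAlgebra B]
  (R : Type u) [CommRing R] (D : GenBoolDynSys B L)

/-- The operators on compatible families attached to the generators of the full system. -/
noncomputable def genEnd : D.full.Gen → Module.End R (families R D)
  | .p A => families.projEnd R D A
  | .s α A _ => families.isoEnd R D α A
  | .sStar α A _ => families.isoStarEnd R D α A

open families in
/-- The representation of the algebra of the full system on compatible families. -/
noncomputable def fullRep : Alg R D.full →ₙₐ[R] Module.End R (families R D) :=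
  lift (genEnd R D) fun a b hab => by
    cases hab with
    | p_bot => rw [freeLift_gen, map_zero]; exact projEnd_bot
    | p_inf A C => simp only [map_mul, freeLift_gen]; exact projEnd_inf A C
    | p_sup A C => simp only [map_sub, map_add, freeLift_gen]; exact projEnd_sup A C
    | p_s A α C hC => simp only [map_mul, freeLift_gen]; exact projEnd_mul_isoEnd A α C
    | sStar_p A α C hC => simp only [map_mul, freeLift_gen]; exact isoStarEnd_mul_projEnd A α C
    | sStar_s α A C hA hC => simp only [map_mul, freeLift_gen]; exact isoStarEnd_mul_isoEnd α A C
    | sStar_s_ne α β h A C hA hC =>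
      simp only [map_mul, map_zero, freeLift_gen]
      exact isoStarEnd_mul_isoEnd_of_ne h A C
    | s_p α A C hA => simp only [map_mul, freeLift_gen]; exact isoEnd_mul_projEnd α A C
    | p_sStar α A C hA => simp only [map_mul, freeLift_gen]; exact projEnd_mul_isoStarEnd α A C
    | p_reg A hA =>
      simp only [map_sum, map_mul, freeLift_gen]
      exact projEnd_of_mem_reg (D := D) hA

variable {R D}

/-- The compatible family `v` has the coordinates `p_A x` and, for `A ∈ I_α`, `s*_{α,A} x`. -/
def Represents (v : families R D) (x : Alg R D) : Prop :=
  (∀ A, v.1.1 A = proj R D A * x) ∧ ∀ α A hA, v.1.2 α A = isoStar R D α A hA * x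

/-- The operators were modelled on left multiplication by the generators. Coordinates with labels
outside I_α are not constrained by x, and none of them is needed. -/
theorem Represents.fullRep_toFull_gen {v : families R D} {x : Alg R D} (h : Represents v x)
    (g : D.Gen) : Represents (fullRep R D (toFull R D (toAlg R D (gen R D g))) v)
      (toAlg R D (gen R D g) * x) := by
  cases g with
  | p C =>
    have : fullRep R D (toFull R D (toAlg R D (gen R D (.p C)))) = families.projEnd R D C :=
      (congrArg _ (toFull_proj C)).trans (lift_gen _ _ _)
    rw [this]
    refine ⟨fun A => ?_, fun α A hA => ?_⟩
    · rw [families.projEnd_fst, h.1, ← proj_mul, mul_assoc]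
      rfl
    · rw [families.projEnd_snd, h.2 _ _ (inf_mem_I_left hA _), ← isoStar_mul_proj hA, mul_assoc]
      rfl
  | s β C hC =>
    have : fullRep R D (toFull R D (toAlg R D (gen R D (.s β C hC)))) =
        families.isoEnd R D β C := (congrArg _ (toFull_iso hC)).trans (lift_gen _ _ _)
    rw [this]
    change Represents _ (iso R D β C hC * x)
    refine ⟨fun A => ?_, fun α A hA => ?_⟩
    · rw [families.isoEnd_fst, h.1, ← mul_assoc, ← mul_assoc, iso_mul_proj, proj_mul_iso]
      exact congrArg (· * x) (iso_congr (by rw [inf_assoc, inf_idem, inf_comm]) _ _)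
    · by_cases hβ : β = α
      · subst hβ
        rw [families.isoEnd_snd, h.1, ← mul_assoc, isoStar_mul_iso]
      · rw [families.isoEnd_snd_of_ne hβ, ← mul_assoc, isoStar_mul_iso_of_ne (Ne.symm hβ),
          zero_mul]
  | sStar β C hC =>
    have : fullRep R D (toFull R D (toAlg R D (gen R D (.sStar β C hC)))) =
        families.isoStarEnd R D β C := (congrArg _ (toFull_isoStar hC)).trans (lift_gen _ _ _)
    rw [this]
    change Represents _ (isoStar R D β C hC * x)
    refine ⟨fun A => ?_, fun α A hA => ?_⟩
    · rw [families.isoStarEnd_fst, h.2 _ _ (inf_mem_I_right hC A), ← mul_assoc, proj_mul_isoStar]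
      exact congrArg (· * x) (isoStar_congr (inf_comm _ _) _ _)
    · rw [families.isoStarEnd_snd, h.2 _ _ hC, ← isoStar_mul_proj hA, mul_assoc,
        ← mul_assoc (proj R D C), proj_mul_isoStar_self]

theorem Represents.fullRep_toFull {v : families R D} {x : Alg R D} (h : Represents v x)
    (a : Alg R D) : Represents (fullRep R D (toFull R D a) v) (a * x) := by
  refine toAlg_induction
    (Pr := fun a => Represents (fullRep R D (toFull R D a) v) (a * x))
    h.fullRep_toFull_gen (fun a b ha hb => ?_) (fun r a ha => ?_) (fun g a ha => ?_) a
  · rw [map_add, map_add, add_mul]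
    exact ⟨fun A => (congrArg₂ _ (ha.1 A) (hb.1 A)).trans (mul_add _ _ _).symm,
      fun α A hA => (congrArg₂ _ (ha.2 α A hA) (hb.2 α A hA)).trans (mul_add _ _ _).symm⟩
  · rw [map_smul, map_smul, smul_mul_assoc]
    exact ⟨fun A => (congrArg (r • ·) (ha.1 A)).trans (mul_smul_comm _ _ _).symm,
      fun α A hA => (congrArg (r • ·) (ha.2 α A hA)).trans (mul_smul_comm _ _ _).symm⟩
  · rw [map_mul, map_mul, mul_assoc]
    exact ha.fullRep_toFull_gen g

/-- The compatible family `(p_A p_C, s*_{α, A ∩ θ_α(C)})`. -/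
noncomputable def familyOfSet (C : B) : families R D :=
  -- The second entry is s*_{α,A} p_C, rewritten so that it makes sense for every A.
  ⟨(fun A => proj R D (A ⊓ C), fun α A => isoStar R D α (A ⊓ D.θ α C) (inf_θ_mem_I α A C)),
    fun A A' => by simp only [proj_mul, inf_assoc],
    fun α A A' => by
      dsimp only
      rw [proj_mul_isoStar]
      exact isoStar_congr (by rw [inf_assoc, inf_comm]) _ _,
    fun α A hA A' => by
      dsimp only
      rw [isoStar_mul_proj]
      exact isoStar_congr (by rw [D.θ_inf, inf_assoc]) _ _⟩

theorem represents_familyOfSet (C : B) :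
    Represents (familyOfSet (R := R) (D := D) C) (proj R D C) :=
  ⟨fun A => (proj_mul A C).symm, fun _ _ hA => (isoStar_mul_proj hA C).symm⟩

theorem Represents.eq_zero {x : Alg R D} (h : Represents (0 : families R D) x) : x = 0 :=
  eq_zero_of_left (fun A => (h.1 A).symm) fun α A hA => (h.2 α A hA).symm

/-- If φ(a) = 0, the zero family represents ax for every representable x, so ax = 0. All p_A and
s_{α,A} are representable, which suffices for a = 0. -/
theorem toFull_injective : Function.Injective (toFull R D) := by
  refine (injective_iff_map_eq_zero _).2 fun a ha => ?_
  have key : ∀ v x, Represents v x → a * x = 0 := fun v x h => by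
    have := h.fullRep_toFull a
    rw [ha, map_zero] at this
    exact this.eq_zero
  refine eq_zero_of_right (fun A => key _ _ (represents_familyOfSet A)) fun α A hA => ?_
  -- Since s_{α,A} = s_{α,A} p_A, it is represented by the image of the family of A under
  -- φ(s_{α,A}).
  rw [← iso_mul_proj_self hA]
  exact key _ _ ((represents_familyOfSet A).fullRep_toFull (iso R D α A hA))

/-! ### The image is a full corner -/

variable (R D)

/-- The elements `y` for which all `p_A y` and `s*_{α,A} y` lie in the image of the algebra. -/
noncomputable def cornerSubmodule : Submodule R (Alg R D.full) where
  carrier := {y | (∀ A, proj R D.full A * y ∈ Set.range (toFull R D)) ∧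
    ∀ α A, isoStar R D.full α A mem_full_I * y ∈ Set.range (toFull R D)}
  zero_mem' := ⟨fun _ => ⟨0, by simp⟩, fun _ _ => ⟨0, by simp⟩⟩
  add_mem' := fun h h' => by
    refine ⟨fun A => ?_, fun α A => ?_⟩
    · obtain ⟨a, ha⟩ := h.1 A
      obtain ⟨b, hb⟩ := h'.1 A
      exact ⟨a + b, by rw [map_add, mul_add, ha, hb]⟩
    · obtain ⟨a, ha⟩ := h.2 α A
      obtain ⟨b, hb⟩ := h'.2 α A
      exact ⟨a + b, by rw [map_add, mul_add, ha, hb]⟩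
  smul_mem' := fun r y h => by
    refine ⟨fun A => ?_, fun α A => ?_⟩
    · obtain ⟨a, ha⟩ := h.1 A
      exact ⟨r • a, by rw [map_smul, mul_smul_comm, ha]⟩
    · obtain ⟨a, ha⟩ := h.2 α A
      exact ⟨r • a, by rw [map_smul, mul_smul_comm, ha]⟩

variable {R D}

theorem mul_mem_range_toFull {x y : Alg R D.full} (hx : x ∈ Set.range (toFull R D))
    (hy : y ∈ Set.range (toFull R D)) : x * y ∈ Set.range (toFull R D) := by
  obtain ⟨a, rfl⟩ := hx
  obtain ⟨b, rfl⟩ := hy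
  exact ⟨a * b, map_mul _ a b⟩

theorem isoStar_full_mem_range {α : L} {A : B} (hA : A ∈ D.I α) :
    isoStar R D.full α A mem_full_I ∈ Set.range (toFull R D) := ⟨_, toFull_isoStar hA⟩

theorem iso_full_mem_range {α : L} {A : B} (hA : A ∈ D.I α) :
    iso R D.full α A mem_full_I ∈ Set.range (toFull R D) := ⟨_, toFull_iso hA⟩

theorem proj_full_mem_range (A : B) :
    proj R D.full A ∈ Set.range (toFull R D) := ⟨_, toFull_proj A⟩

/-- The second factor absorbs p_C on its left, and moving p_C through the first cuts its label down
to one in I_α. -/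
theorem isoStar_mul_isoStar_full (α β : L) (A C : B) :
    isoStar R D.full α A mem_full_I * isoStar R D.full β C mem_full_I =
      isoStar R D.full α (A ⊓ D.θ α C) mem_full_I * isoStar R D.full β C mem_full_I := by
  rw [← proj_mul_isoStar_self (D := D.full) (A := C) mem_full_I, ← mul_assoc, ← mul_assoc,
    isoStar_mul_proj, isoStar_mul_proj]
  exact congrArg (· * _) (isoStar_congr (by rw [inf_assoc]; exact congrArg _ (inf_idem _).symm) _ _)

theorem gen_mul_mem_cornerSubmodule (g : D.full.Gen) {y : Alg R D.full}
    (hy : y ∈ cornerSubmodule R D) : toAlg R D.full (gen R D.full g) * y ∈ cornerSubmodule R D := by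
  cases g with
  | p C =>
    refine ⟨fun A => ?_, fun α A => ?_⟩
    · change proj R D.full A * (proj R D.full C * y) ∈ _
      rw [← mul_assoc, proj_mul]
      exact hy.1 _
    · change isoStar R D.full α A mem_full_I * (proj R D.full C * y) ∈ _
      rw [← mul_assoc, isoStar_mul_proj]
      exact hy.2 _ _
  | s β C hC =>
    refine ⟨fun A => ?_, fun α A => ?_⟩
    · change proj R D.full A * (iso R D.full β C mem_full_I * y) ∈ _
      rw [← mul_assoc, proj_mul_iso, ← iso_mul_proj_self, mul_assoc]
      exact mul_mem_range_toFull (iso_full_mem_range (inf_θ_mem_I β C A)) (hy.1 _)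
    · change isoStar R D.full α A mem_full_I * (iso R D.full β C mem_full_I * y) ∈ _
      rw [← mul_assoc]
      by_cases h : α = β
      · subst h
        rw [isoStar_mul_iso]
        exact hy.1 _
      · rw [isoStar_mul_iso_of_ne h, zero_mul]
        exact ⟨0, map_zero _⟩
  | sStar β C hC =>
    refine ⟨fun A => ?_, fun α A => ?_⟩
    · change proj R D.full A * (isoStar R D.full β C mem_full_I * y) ∈ _
      rw [← mul_assoc, proj_mul_isoStar]
      exact hy.2 _ _
    · change isoStar R D.full α A mem_full_I * (isoStar R D.full β C mem_full_I * y) ∈ _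
      rw [← mul_assoc, isoStar_mul_isoStar_full, mul_assoc]
      exact mul_mem_range_toFull (isoStar_full_mem_range (inf_θ_mem_I α A C)) (hy.2 _ _)

/-- `cornerSubmodule` is a left ideal of T; as it contains φ(S), it contains Tφ(S). -/
theorem mul_mem_cornerSubmodule (c : Alg R D.full) {y : Alg R D.full}
    (hy : y ∈ cornerSubmodule R D) : c * y ∈ cornerSubmodule R D := by
  refine toAlg_induction (Pr := fun c => c * y ∈ cornerSubmodule R D)
    (fun g => gen_mul_mem_cornerSubmodule g hy) (fun a b ha hb => ?_) (fun r a ha => ?_)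
    (fun g a ha => ?_) c
  · rw [add_mul]; exact Submodule.add_mem _ ha hb
  · rw [smul_mul_assoc]; exact Submodule.smul_mem _ r ha
  · rw [mul_assoc]; exact gen_mul_mem_cornerSubmodule g ha

theorem gen_mul_mem_range {g : D.Gen} {y : Alg R D.full} (hy : y ∈ cornerSubmodule R D) :
    toFull R D (toAlg R D (gen R D g)) * y ∈ Set.range (toFull R D) := by
  cases g with
  | p A =>
    change toFull R D (proj R D A) * y ∈ _
    rw [toFull_proj]
    exact hy.1 A
  | s α A hA =>
    change toFull R D (iso R D α A hA) * y ∈ _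
    rw [← iso_mul_proj_self, map_mul, toFull_proj, mul_assoc]
    exact mul_mem_range_toFull ⟨_, rfl⟩ (hy.1 A)
  | sStar α A hA =>
    change toFull R D (isoStar R D α A hA) * y ∈ _
    rw [toFull_isoStar]
    exact hy.2 α A

/-- The generators p_A and s*_{α,A} are covered by the definition of `cornerSubmodule`, and s_{α,A}
= s_{α,A} p_A reduces to p_A. -/
theorem toFull_mul_mem_range (a : Alg R D) {y : Alg R D.full} (hy : y ∈ cornerSubmodule R D) :
    toFull R D a * y ∈ Set.range (toFull R D) := by
  refine toAlg_induction (Pr := fun a => toFull R D a * y ∈ Set.range (toFull R D))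
    (fun g => gen_mul_mem_range hy) ?_ ?_ (fun g a ha => ?_) a
  · rintro a b ⟨a', ha⟩ ⟨b', hb⟩
    exact ⟨a' + b', by rw [map_add, map_add, add_mul, ha, hb]⟩
  · rintro r a ⟨a', ha⟩
    exact ⟨r • a', by rw [map_smul, map_smul, smul_mul_assoc, ha]⟩
  · rw [map_mul, mul_assoc]
    exact mul_mem_range_toFull ⟨_, rfl⟩ ha

theorem toFull_gen_mem_cornerSubmodule (g : D.Gen) :
    toFull R D (toAlg R D (gen R D g)) ∈ cornerSubmodule R D := by
  refine ⟨fun A => mul_mem_range_toFull (proj_full_mem_range A) ⟨_, rfl⟩, fun α A => ?_⟩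
  cases g with
  | p C =>
    change _ * toFull R D (proj R D C) ∈ _
    rw [toFull_proj, isoStar_mul_proj]
    exact isoStar_full_mem_range (inf_θ_mem_I α A C)
  | s β C hC =>
    change _ * toFull R D (iso R D β C hC) ∈ _
    rw [toFull_iso]
    by_cases h : α = β
    · subst h
      rw [isoStar_mul_iso]
      exact proj_full_mem_range _
    · rw [isoStar_mul_iso_of_ne h]
      exact ⟨0, map_zero _⟩
  | sStar β C hC =>
    change _ * toFull R D (isoStar R D β C hC) ∈ _
    rw [toFull_isoStar, isoStar_mul_isoStar_full]
    exact mul_mem_range_toFull (isoStar_full_mem_range (inf_θ_mem_I α A C))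
      (isoStar_full_mem_range hC)

theorem toFull_mem_cornerSubmodule (a : Alg R D) : toFull R D a ∈ cornerSubmodule R D := by
  refine toAlg_induction (Pr := fun a => toFull R D a ∈ cornerSubmodule R D)
    toFull_gen_mem_cornerSubmodule (fun a b ha hb => ?_) (fun r a ha => ?_) (fun g a ha => ?_) a
  · rw [map_add]; exact Submodule.add_mem _ ha hb
  · rw [map_smul]; exact Submodule.smul_mem _ r ha
  · rw [map_mul]; exact mul_mem_cornerSubmodule _ ha

theorem span_mul_eq_top : Submodule.span R {x : Alg R D | ∃ a b, a * b = x} = ⊤ := by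
  refine eq_top_iff.2 fun x _ => ?_
  refine toAlg_induction (fun g => ?_) (fun _ _ => Submodule.add_mem _)
    (fun r _ => Submodule.smul_mem _ r) (fun g x _ => ?_) x
  swap
  · exact Submodule.subset_span ⟨_, _, rfl⟩
  obtain ⟨e, _, h⟩ := exists_localUnit_mul_gen (R := R) g
  exact Submodule.subset_span ⟨_, _, h⟩

/-- The elements φ(p_A) already suffice: every generator absorbs one of them, on the left or on the
right. -/
theorem span_mul_toFull_mul_eq_top :
    Submodule.span R {x : Alg R D.full | ∃ c a d, c * toFull R D a * d = x} = ⊤ := by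
  have hgen : ∀ g, ∃ c a d, c * toFull R D a * d = toAlg R D.full (gen R D.full g) := fun g => by
    cases g with
    | p A =>
      exact ⟨proj R D.full A, proj R D A, proj R D.full A, by
        rw [toFull_proj, proj_mul_self, proj_mul_self]; rfl⟩
    | s α A hA =>
      exact ⟨iso R D.full α A mem_full_I, proj R D A, proj R D.full A, by
        rw [toFull_proj, iso_mul_proj_self, iso_mul_proj_self]; rfl⟩
    | sStar α A hA =>
      exact ⟨proj R D.full A, proj R D A, isoStar R D.full α A mem_full_I, by
        rw [toFull_proj, proj_mul_self, proj_mul_isoStar_self]; rfl⟩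
  refine eq_top_iff.2 fun x _ => ?_
  refine toAlg_induction (fun g => ?_) (fun _ _ => Submodule.add_mem _)
    (fun r _ => Submodule.smul_mem _ r) (fun g x _ => ?_) x
  · exact Submodule.subset_span (hgen g)
  · obtain ⟨c, a, d, h⟩ := hgen g
    exact Submodule.subset_span ⟨c, a, d * x, by rw [← mul_assoc, h]⟩

end GenBoolDynSys

theorem mainTheorem8 {R : Type u} [CommRing R] {B : Type v} {L : Type w}
    [GeneralizedBooleanAlgebra B] (D : GenBoolDynSys B L) :
    MoritaEquivalent R (GenBoolDynSys.Alg R D) (GenBoolDynSys.Alg R D.full) :=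
  moritaEquivalent_of_full_corner (GenBoolDynSys.toFull R D) GenBoolDynSys.toFull_injective
    GenBoolDynSys.span_mul_eq_top
    (fun a c b => by
      rw [mul_assoc]
      exact GenBoolDynSys.toFull_mul_mem_range a
        (GenBoolDynSys.mul_mem_cornerSubmodule c (GenBoolDynSys.toFull_mem_cornerSubmodule b)))
    GenBoolDynSys.span_mul_toFull_mul_eq_top
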